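/- For $m\ge 1$ and positive integers $s_1,\dots,s_m$ put $$\zeta(s_1,\dots,s_m)=\sum_{n_1>n_2>\cdots>n_m>0}\frac1{n_1^{s_1}\cdots n_m^{s_m}},\qquad \zeta_N(s_1,\dots,s_m)=\sum_{N\ge n_1>n_2>\cdots>n_m>0}\frac1{n_1^{s_1}\cdots n_m^{s_m}} .$$ The series $\zeta(s_1,\dots,s_m)$ converges whenever $s_1\ge 2$. Let $m\ge 2$, let $k_1,\dots,k_m$ be positive integers with $k_1\ge 2$, and set $n_m:=k_m$. Then $$ \begin{aligned} \zeta(k_1,\dots,k_m)={}&\sum_{j=1}^{m-1}(-1)^{k_m}\sum_{n_{m-1}=1}^{n_m}\sum_{n_{m-2}=1}^{n_{m-1}}\cdots\sum_{n_{j+1}=1}^{n_{j+2}}\ \sum_{n_j=1}^{k_j}\ \prod_{i=j+1}^{m-1}\binom{k_i-n_i+n_{i+1}-1}{k_i-1}\binom{k_j-n_j+n_{j+1}-1}{n_{j+1}-1}\\ &\qquad\times\zeta(k_1,\dots,k_{j-1},\,n_j,\,k_j-n_j+n_{j+1},\dots,k_{m-1}-n_{m-1}+n_m)\\ &+\sum_{n_{m-1}=1}^{n_m}\cdots\sum_{n_1=1}^{n_2}(-1)^{k_m-n_1}\prod_{i=1}^{m-1}\binom{k_i-n_i+n_{i+1}-1}{k_i-1}\,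 \zeta(n_1)\,\zeta(k_1-n_1+n_2,\dots,k_{m-1}-n_{m-1}+n_m). \end{aligned}\qquad(*) $$ The divergent terms on the right-hand side (those with $n_1=1$, in the sum for $j=1$ and in the last sum) occur only in combinations $\zeta(1)\zeta(s_1,\dots,s_{m-1})-\zeta(1,s_1,\dots,s_{m-1})$ with $s_1\ge 2$, and $(*)$ holds in both of the following senses. (i) If every $\zeta$ on the right-hand side of $(*)$ is replaced by $\zeta_N$, the right-hand side tends to $\zeta(k_1,\dots,k_m)$ as $N\to\infty$. (ii) The equation $(*)$ holds exactly, as an identity between convergent sums, when each combination $\zeta(1)\zeta(s_1,\dots,s_{m-1})-\zeta(1,s_1,\dots,s_{m-1})$ formed by the terms with $n_1=1$ is replaced by $$\sum_{\kappa=1}^{m-1}\bigl[\zeta(s_1,\dots,s_{\kappa-1},s_\kappa+1,s_{\kappa+1},\dots,s_{m-1})+\zeta(s_1,\dots,s_\kappa,1,s_{\kappa+1},\dots,s_{m-1})\bigr].$$ Moreover, for every $r\ge 1$ and all positive integers $s_1,\dots,s_r$ with $s_1\ge2$, $$\lim_{N\to\infty}\bigl(\zeta_N(1)\zeta_N(s_1,\dots,s_r)-\zeta_N(1,s_1,\dots,s_r)\bigr)=\sum_{\kappa=1}^{r}\bigl[\zeta(s_1,\dots,s_\kappa+1,\dots,s_r)+\zeta(s_1,\dots,s_\kappa,1,s_{\kappa+1},\dots,s_r)\bigr].$$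 -/

import Mathlib

open Filter Topology

/-- The index set `{(n₁, …, n_m) : n₁ > n₂ > ⋯ > n_m > 0}` of the Euler–Zagier sums of length `m`. -/
def MZVIndex (m : ℕ) : Type :=
  {n : Fin m → ℕ // StrictAnti n ∧ ∀ i, 0 < n i}

/-- The summand `1 / (n₁ ^ s₁ ⋯ n_m ^ s_m)`. Arguments are numbered from `1`: only the values
`s 1, …, s m` of `s : ℕ → ℕ` matter. -/
noncomputable def mzvTerm (m : ℕ) (s : ℕ → ℕ) (n : Fin m → ℕ) : ℝ :=
  1 / ∏ i : Fin m, (n i : ℝ) ^ s (i.val + 1)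

/-- The multiple zeta value `ζ(s₁, …, s_m) = ∑_{n₁ > ⋯ > n_m > 0} 1 / (n₁ ^ s₁ ⋯ n_m ^ s_m)`. -/
noncomputable def mzv (m : ℕ) (s : ℕ → ℕ) : ℝ :=
  ∑' n : MZVIndex m, mzvTerm m s n.val

open Classical in
/-- The cut-off sum `ζ_N(s₁, …, s_m) = ∑_{N ≥ n₁ > ⋯ > n_m > 0} 1 / (n₁ ^ s₁ ⋯ n_m ^ s_m)`. -/
noncomputable def mzvCut (N : ℕ) (m : ℕ) (s : ℕ → ℕ) : ℝ :=
  ∑ n ∈ (Fintype.piFinset fun _ : Fin m => Finset.Icc 1 N).filter StrictAnti, mzvTerm m s n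

/-- Convergent arguments `(s₁, …, s_m)`: positive integers with `s₁ ≥ 2`. -/
def MZVAdmissible (m : ℕ) (s : ℕ → ℕ) : Prop :=
  2 ≤ s 1 ∧ ∀ i ∈ Finset.Icc 1 m, 1 ≤ s i

/-- The iterated sum
`∑_{n_{a+c-1} = 1}^{n_{a+c}} ∑_{n_{a+c-2} = 1}^{n_{a+c-1}} ⋯ ∑_{n_a = 1}^{n_{a+1}} F(n)`
(`c` summations); the entries of `n` other than `n_a, …, n_{a+c-1}` stay as they are given. -/
def nestedSum (F : (ℕ → ℕ) → ℝ) (a : ℕ) : ℕ → (ℕ → ℕ) → ℝ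
  | 0, n => F n
  | c + 1, n => ∑ x ∈ Finset.Icc 1 (n (a + c + 1)), nestedSum F a c (Function.update n (a + c) x)

/-- The number `k_i - n_i + n_{i+1}`. -/
def shiftedArg (k n : ℕ → ℕ) (i : ℕ) : ℕ :=
  k i + n (i + 1) - n i

/-- The product `∏_{i = a}^{m-1} binom(k_i - n_i + n_{i+1} - 1, k_i - 1)`. -/
def binomProd (m : ℕ) (k n : ℕ → ℕ) (a : ℕ) : ℝ :=
  ∏ i ∈ Finset.Ico a m, ((shiftedArg k n i - 1).choose (k i - 1) : ℝ)

/-- The length-`m` arguments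
`(k₁, …, k_{j-1}, n_j, k_j - n_j + n_{j+1}, …, k_{m-1} - n_{m-1} + n_m)`. -/
def boundaryArgs (k n : ℕ → ℕ) (j : ℕ) : ℕ → ℕ := fun i =>
  if i < j then k i else if i = j then n j else shiftedArg k n (i - 1)

/-- With `n_m = k_m`, and with `Z` in the role of `ζ`:
`(-1)^{k_m} ∑_{n_{m-1} = 1}^{n_m} ⋯ ∑_{n_{j+1} = 1}^{n_{j+2}} ∑_{n_j = l}^{k_j}
  ∏_{i = j+1}^{m-1} binom(k_i - n_i + n_{i+1} - 1, k_i - 1) binom(k_j - n_j + n_{j+1} - 1, n_{j+1} - 1)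
  Z(k₁, …, k_{j-1}, n_j, k_j - n_j + n_{j+1}, …, k_{m-1} - n_{m-1} + n_m)`. -/
noncomputable def boundarySum (Z : ℕ → (ℕ → ℕ) → ℝ) (m : ℕ) (k : ℕ → ℕ) (j l : ℕ) : ℝ :=
  (-1) ^ k m *
    nestedSum
      (fun n' => ∑ x ∈ Finset.Icc l (k j),
        let n := Function.update n' j x
        binomProd m k n (j + 1) * ((shiftedArg k n j - 1).choose (n (j + 1) - 1) : ℝ) *
          Z m (boundaryArgs k n j))
      (j + 1) (m - 1 - j) k

/-- With `n_m = k_m`, and with `Z` in the role of `ζ`: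
`∑_{n_{m-1} = 1}^{n_m} ⋯ ∑_{n_2 = 1}^{n_3} ∑_{n_1 = l}^{n_2} (-1)^{k_m - n_1}
  ∏_{i = 1}^{m-1} binom(k_i - n_i + n_{i+1} - 1, k_i - 1)
  Z(n_1) Z(k_1 - n_1 + n_2, …, k_{m-1} - n_{m-1} + n_m)`. -/
noncomputable def productSum (Z : ℕ → (ℕ → ℕ) → ℝ) (m : ℕ) (k : ℕ → ℕ) (l : ℕ) : ℝ :=
  nestedSum
    (fun n' => ∑ x ∈ Finset.Icc l (n' 2),
      let n := Function.update n' 1 x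
      (-1) ^ (k m - n 1) * binomProd m k n 1 * (Z 1 (fun _ => n 1) * Z (m - 1) (shiftedArg k n)))
    2 (m - 2) k

/-- The arguments `(1, s₁, s₂, …)`. -/
def consOne (s : ℕ → ℕ) : ℕ → ℕ := fun i => if i = 1 then 1 else s (i - 1)

/-- The arguments `(s₁, …, s_{κ-1}, s_κ + 1, s_{κ+1}, …)`. -/
def raiseAt (s : ℕ → ℕ) (κ : ℕ) : ℕ → ℕ := fun i => if i = κ then s i + 1 else s i

/-- The arguments `(s₁, …, s_κ, 1, s_{κ+1}, …)`. -/
def insertOneAfter (s : ℕ → ℕ) (κ : ℕ) : ℕ → ℕ := fun i =>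
  if i ≤ κ then s i else if i = κ + 1 then 1 else s (i - 1)

/-- The convergent value of the combination `ζ(1) ζ(s₁, …, s_r) - ζ(1, s₁, …, s_r)`, namely
`∑_{κ = 1}^{r} [ζ(s₁, …, s_κ + 1, …, s_r) + ζ(s₁, …, s_κ, 1, s_{κ+1}, …, s_r)]`. -/
noncomputable def reflSum (r : ℕ) (s : ℕ → ℕ) : ℝ :=
  ∑ κ ∈ Finset.Icc 1 r, (mzv r (raiseAt s κ) + mzv (r + 1) (insertOneAfter s κ))

/-- What the terms with `n_1 = 1` contribute, once `Z(1) Z(s) - Z(1, s)` is replaced by its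
convergent value:
`-(-1)^{k_m} ∑_{n_{m-1} = 1}^{n_m} ⋯ ∑_{n_2 = 1}^{n_3}
  ∏_{i = 1}^{m-1} binom(k_i - n_i + n_{i+1} - 1, k_i - 1) reflSum(k_1 - 1 + n_2, …)`,
with `n_1 = 1` and `n_m = k_m`. -/
noncomputable def cancelledSum (m : ℕ) (k : ℕ → ℕ) : ℝ :=
  -(-1) ^ k m *
    nestedSum
      (fun n' =>
        let n := Function.update n' 1 1
        binomProd m k n 1 * reflSum (m - 1) (shiftedArg k n))
      2 (m - 2) k

/-! A cut-off sum is a composite of the operators `powSum (k i)` applied to the constant `1`. The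
innermost `powSum (k m) 1` is also the convolution `convSum (k m) 1`, and this form can be pushed
outwards through the other operators.

The push is a partial fraction expansion. In `powSum k (convSum n h)` the outer variable is a sum `q
= p + a` of positive integers, so `u = 1/q`, `v = 1/a`, `w = 1/p` satisfy `u * v = w * (v - u)`.
Hence `u ^ k * v ^ n` is a combination of `w ^ _ * u ^ x`, which are iterated power sums again (the
boundary terms), and of `w ^ _ * v ^ x`, which are convolutions to be pushed further
(`powSum_convSum`). Pushing past all operators gives an exact identity for each `N`
(`iterSum_convSum_eq`, `mzvCut_eq_sum_boundarySum`), of the required shape except that it has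
convolutions instead of products.

A convolution sums over the triangle `p + a ≤ N`, the product over the square `p, a ≤ N`. Their
difference tends to `0` by dominated convergence (`tendsto_mul_sub_convSum`), even when `ζ_N(1)` is
a factor, because the other factor is convergent with only logarithmic growth in its terms'
numerators. This is sense (i).

For sense (ii), the terms with `n_1 = 1` have equal binomials and opposite signs, so they pair up
into `ζ_N(1) ζ_N(s) - ζ_N(1, s)`, which the stuffle product turns into a finite sum of convergent
cut-off sums (`mzvCut_one_mul_sub`). -/

/-! ### Summation operators and their linearity -/

/-- The weighted partial sum `∑_{i < N} f i / (i + 1) ^ e`. -/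
noncomputable def powSum (e : ℕ) (f : ℕ → ℝ) (N : ℕ) : ℝ :=
  ∑ i ∈ Finset.range N, f i * ((i : ℝ) + 1)⁻¹ ^ e

/-- The convolution `∑_{a < N} h (N - 1 - a) / (a + 1) ^ e`. -/
noncomputable def convSum (e : ℕ) (h : ℕ → ℝ) (N : ℕ) : ℝ :=
  ∑ a ∈ Finset.range N, h (N - 1 - a) * ((a : ℝ) + 1)⁻¹ ^ e

/-- The operators `powSum (s a), …, powSum (s (a + c - 1))` applied to `f`, the last one first. -/
noncomputable def iterSum (s : ℕ → ℕ) : ℕ → ℕ → (ℕ → ℝ) → ℕ → ℝ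
  | _, 0, f => f
  | a, c + 1, f => powSum (s a) (iterSum s (a + 1) c f)

theorem powSum_succ (e : ℕ) (f : ℕ → ℝ) (N : ℕ) :
    powSum e f (N + 1) = powSum e f N + f N * ((N : ℝ) + 1)⁻¹ ^ e := by
  simp [powSum, Finset.sum_range_succ]

@[simp] theorem powSum_zero (e : ℕ) (f : ℕ → ℝ) : powSum e f 0 = 0 := by
  simp [powSum]

theorem powSum_add (e : ℕ) (f g : ℕ → ℝ) : powSum e (f + g) = powSum e f + powSum e g := by
  funext N
  simp [powSum, add_mul, Finset.sum_add_distrib]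

theorem powSum_sum {ι : Type*} (e : ℕ) (t : Finset ι) (f : ι → ℕ → ℝ) :
    powSum e (∑ i ∈ t, f i) = ∑ i ∈ t, powSum e (f i) := by
  funext N
  simp only [powSum, Finset.sum_apply, Finset.sum_mul]
  exact Finset.sum_comm

theorem powSum_smul (e : ℕ) (c : ℝ) (f : ℕ → ℝ) : powSum e (c • f) = c • powSum e f := by
  funext N
  simp [powSum, Finset.mul_sum, mul_assoc]

theorem iterSum_congr {s t : ℕ → ℕ} {a b c : ℕ} (f : ℕ → ℝ)
    (h : ∀ i < c, s (a + i) = t (b + i)) : iterSum s a c f = iterSum t b c f := by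
  induction c generalizing a b with
  | zero => rfl
  | succ c ih =>
    have h0 : s a = t b := by simpa using h 0 (by omega)
    simp only [iterSum, h0]
    rw [ih (a := a + 1) (b := b + 1)]
    intro i hi
    simpa [add_assoc, add_comm 1 i] using h (i + 1) (by omega)

theorem iterSum_add_length (s : ℕ → ℕ) (a c d : ℕ) (f : ℕ → ℝ) :
    iterSum s a (c + d) f = iterSum s a c (iterSum s (a + c) d f) := by
  induction c generalizing a with
  | zero => simp [iterSum]
  | succ c ih =>
    rw [show c + 1 + d = (c + d) + 1 by ring]
    simp only [iterSum]
    rw [ih, show a + 1 + c = a + (c + 1) by ring]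

theorem iterSum_succ_last (s : ℕ → ℕ) (a c : ℕ) (f : ℕ → ℝ) :
    iterSum s a (c + 1) f = iterSum s a c (powSum (s (a + c)) f) :=
  iterSum_add_length s a c 1 f

theorem iterSum_add (s : ℕ → ℕ) (a c : ℕ) (f g : ℕ → ℝ) :
    iterSum s a c (f + g) = iterSum s a c f + iterSum s a c g := by
  induction c generalizing a with
  | zero => rfl
  | succ c ih => simp only [iterSum, ih, powSum_add]

theorem iterSum_sum {ι : Type*} (s : ℕ → ℕ) (a c : ℕ) (t : Finset ι) (f : ι → ℕ → ℝ) :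
    iterSum s a c (∑ i ∈ t, f i) = ∑ i ∈ t, iterSum s a c (f i) := by
  induction c generalizing a with
  | zero => rfl
  | succ c ih => simp only [iterSum, ih, powSum_sum]

theorem iterSum_smul (s : ℕ → ℕ) (a c : ℕ) (r : ℝ) (f : ℕ → ℝ) :
    iterSum s a c (r • f) = r • iterSum s a c f := by
  induction c generalizing a with
  | zero => rfl
  | succ c ih => simp only [iterSum, ih, powSum_smul]

/-! ### Cut-off sums as iterated operators -/

theorem strictAnti_fin_cons_iff {m : ℕ} (a : ℕ) (n : Fin m → ℕ) :
    StrictAnti (Fin.cons a n : Fin (m + 1) → ℕ) ↔ (∀ i, n i < a) ∧ StrictAnti n := by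
  constructor
  · intro h
    refine ⟨fun i => ?_, fun i j hij => ?_⟩
    · simpa using h (Fin.succ_pos i)
    · simpa using h (Fin.succ_lt_succ_iff.2 hij)
  · rintro ⟨h0, h⟩ i j hij
    induction i using Fin.cases with
    | zero =>
      induction j using Fin.cases with
      | zero => exact absurd hij (lt_irrefl _)
      | succ j => simpa using h0 j
    | succ i =>
      induction j using Fin.cases with
      | zero => exact absurd hij (by simp)
      | succ j => simpa using h (Fin.succ_lt_succ_iff.1 hij)

theorem mzvTerm_cons (m : ℕ) (s : ℕ → ℕ) (a : ℕ) (n : Fin m → ℕ) :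
    mzvTerm (m + 1) s (Fin.cons a n : Fin (m + 1) → ℕ) =
      mzvTerm m (fun j => s (j + 1)) n * (a : ℝ)⁻¹ ^ s 1 := by
  simp [mzvTerm, Fin.prod_univ_succ, mul_comm]

/-- The largest entry is split off as `i + 1`; the remaining entries are then at most `i`. The shift
by one in `powSum` is what encodes the strict inequalities. -/
theorem mzvCut_succ (N m : ℕ) (s : ℕ → ℕ) :
    mzvCut N (m + 1) s = powSum (s 1) (fun i => mzvCut i m (fun j => s (j + 1))) N := by
  classical
  simp only [mzvCut, powSum, Finset.sum_mul]
  rw [Finset.sum_sigma']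
  symm
  refine Finset.sum_nbij' (fun x => (Fin.cons (x.1 + 1) x.2 : Fin (m + 1) → ℕ))
    (fun n => ⟨n 0 - 1, Fin.tail n⟩) ?_ ?_ ?_ ?_ ?_
  · rintro ⟨i, n⟩ h
    simp only [Finset.mem_sigma, Finset.mem_range, Finset.mem_filter, Fintype.mem_piFinset,
      Finset.mem_Icc] at h ⊢
    refine ⟨fun j => ?_, (strictAnti_fin_cons_iff _ _).2 ⟨fun j => ?_, h.2.2⟩⟩
    · induction j using Fin.cases with
      | zero => simp; omega
      | succ j => have := h.2.1 j; simp; omega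
    · have := h.2.1 j; omega
  · intro n h
    simp only [Finset.mem_sigma, Finset.mem_range, Finset.mem_filter, Fintype.mem_piFinset,
      Finset.mem_Icc] at h ⊢
    have h0 := h.1 0
    have hn := h.2
    rw [← Fin.cons_self_tail n, strictAnti_fin_cons_iff] at hn
    refine ⟨by omega, fun j => ?_, hn.2⟩
    have h1 := hn.1 j
    have h2 := h.1 j.succ
    simp only [Fin.tail] at h1 ⊢
    omega
  · rintro ⟨i, n⟩ h
    simp
  · intro n h
    simp only [Finset.mem_filter, Fintype.mem_piFinset, Finset.mem_Icc] at h
    have h0 := h.1 0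
    simp only
    rw [Nat.sub_add_cancel h0.1, Fin.cons_self_tail]
  · rintro ⟨i, n⟩ h
    rw [mzvTerm_cons]
    simp

theorem mzvCut_eq_iterSum (N m : ℕ) (s : ℕ → ℕ) : mzvCut N m s = iterSum s 1 m 1 N := by
  induction m generalizing N s with
  | zero =>
    simp [mzvCut, iterSum, mzvTerm, Subsingleton.strictAnti]
  | succ m ih =>
    rw [mzvCut_succ]
    simp only [iterSum]
    congr 1
    funext i
    rw [ih, iterSum_congr]
    intro i _
    simp [add_comm, add_left_comm]

theorem mzvCut_one (N : ℕ) (s : ℕ → ℕ) : mzvCut N 1 s = powSum (s 1) 1 N :=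
  mzvCut_eq_iterSum N 1 s

/-! ### Convolutions and partial fractions -/

/-- A constant function does not see the reversal of its argument. This is where the recursion on
convolutions starts. -/
theorem convSum_one (e : ℕ) : convSum e 1 = powSum e 1 := rfl

/-- Raising the cut-off adds exactly the antidiagonal on which the two positive variables `M - a`
and `a + 1` sum to `M + 1`; the new term `a = M` vanishes because `powSum e h 0 = 0`. -/
theorem convSum_powSum_succ (x e : ℕ) (h : ℕ → ℝ) (M : ℕ) :
    convSum x (powSum e h) (M + 1) = convSum x (powSum e h) M +
      ∑ a ∈ Finset.range M,
        h (M - 1 - a) * (((M - 1 - a : ℕ) : ℝ) + 1)⁻¹ ^ e * ((a : ℝ) + 1)⁻¹ ^ x := by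
  simp only [convSum, Finset.sum_range_succ]
  rw [← Finset.sum_add_distrib]
  simp only [Nat.add_sub_cancel, Nat.sub_self, powSum_zero, zero_mul, add_zero]
  refine Finset.sum_congr rfl fun a ha => ?_
  have ha := Finset.mem_range.1 ha
  rw [show M - a = (M - 1 - a) + 1 by omega, powSum_succ]
  ring

theorem powSum_reflect (e : ℕ) (h : ℕ → ℝ) (M : ℕ) :
    powSum e h M =
      ∑ a ∈ Finset.range M, h (M - 1 - a) * (((M - 1 - a : ℕ) : ℝ) + 1)⁻¹ ^ e := by
  rw [powSum]
  exact (Finset.sum_range_reflect (fun i => h i * ((i : ℝ) + 1)⁻¹ ^ e) M).symm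

/-- Pascal's rule, summed against the monomials. -/
theorem sum_choose_recurrence {R : Type*} [CommRing R] (K L : ℕ) (u w : R) :
    ∑ j ∈ Finset.range (K + 2), ((j + (L + 1)).choose (L + 1) : R) * u ^ (K + 1 - j) * w ^ j =
      ∑ j ∈ Finset.range (K + 2), ((j + L).choose L : R) * u ^ (K + 1 - j) * w ^ j +
      w * ∑ j ∈ Finset.range (K + 1), ((j + (L + 1)).choose (L + 1) : R) * u ^ (K - j) * w ^ j := by
  rw [Finset.sum_range_succ', Finset.sum_range_succ' _ (K + 1), Finset.mul_sum, add_right_comm,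
    ← Finset.sum_add_distrib]
  congr 1
  · refine Finset.sum_congr rfl fun j _ => ?_
    rw [show j + 1 + (L + 1) = (j + 1 + L) + 1 by ring, Nat.choose_succ_succ,
      show j + (L + 1) = j + 1 + L by ring, show K + 1 - (j + 1) = K - j by omega]
    push_cast
    ring
  · simp

/-- Double induction on the exponents. Only the relation `huv` is used, so no division is needed. -/
theorem pow_mul_pow_eq_of_mul_eq {R : Type*} [CommRing R] {u v w : R} (huv : u * v = w * (v - u))
    (K L : ℕ) :
    u ^ (K + 1) * v ^ (L + 1) =
      (-1) ^ (L + 1) * u * w ^ (L + 1) *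
          ∑ j ∈ Finset.range (K + 1), ((j + L).choose L : R) * u ^ (K - j) * w ^ j +
        v * w ^ (K + 1) *
          ∑ j ∈ Finset.range (L + 1), ((j + K).choose K : R) * v ^ (L - j) * (-w) ^ j := by
  have step : ∀ (x y : R) (M : ℕ),
      ∑ j ∈ Finset.range (M + 2), ((j + 0).choose 0 : R) * x ^ (M + 1 - j) * y ^ j =
        x * ∑ j ∈ Finset.range (M + 1), ((j + 0).choose 0 : R) * x ^ (M - j) * y ^ j +
          y ^ (M + 1) := by
    intro x y M
    rw [Finset.sum_range_succ, Finset.mul_sum]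
    simp only [Nat.choose_zero_right, Nat.cast_one, one_mul, Nat.sub_self, pow_zero]
    congr 1
    refine Finset.sum_congr rfl fun j hj => ?_
    have := Finset.mem_range.1 hj
    rw [show M + 1 - j = (M - j) + 1 by omega]
    ring
  induction K generalizing L with
  | zero =>
    induction L with
    | zero => simp; linear_combination huv
    | succ L ih =>
      rw [step v (-w) L]
      simp only [zero_add, pow_one, Finset.range_one, Finset.sum_singleton] at ih ⊢
      simp only [Nat.choose_self, Nat.cast_one, Nat.sub_zero, pow_zero, mul_one] at ih ⊢
      rw [neg_pow w (L + 1)]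
      linear_combination v * ih + (-1) ^ (L + 1) * w ^ (L + 1) * huv
  | succ K ih =>
    induction L with
    | zero =>
      have h0 := ih 0
      rw [step u w K]
      simp only [zero_add, pow_one, Finset.range_one, Finset.sum_singleton] at h0 ⊢
      simp only [Nat.choose_self, Nat.cast_one, Nat.sub_zero, pow_zero, mul_one] at h0 ⊢
      linear_combination u * h0 + w ^ (K + 1) * huv
    | succ L ihL =>
      have h1 := ih (L + 1)
      rw [sum_choose_recurrence, sum_choose_recurrence]
      -- One factor `u * v` becomes `w * (v - u)`; `h1` and `ihL` expand the two resulting monomials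
      -- in `u` and `v`.
      linear_combination w * h1 - w * ihL + u ^ (K + 1) * v ^ (L + 1) * huv

theorem pow_mul_pow_partial_fractions {R : Type*} [CommRing R] {u v w : R}
    (huv : u * v = w * (v - u)) {k n : ℕ} (hk : 1 ≤ k) (hn : 1 ≤ n) :
    u ^ k * v ^ n =
      ∑ x ∈ Finset.Icc 1 k,
          (-1) ^ n * ((k + n - x - 1).choose (n - 1) : R) * (w ^ (k + n - x) * u ^ x) +
        ∑ x ∈ Finset.Icc 1 n,
          (-1) ^ (n - x) * ((k + n - x - 1).choose (k - 1) : R) * (w ^ (k + n - x) * v ^ x) := by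
  obtain ⟨K, rfl⟩ := Nat.exists_eq_add_of_le' hk
  obtain ⟨L, rfl⟩ := Nat.exists_eq_add_of_le' hn
  have reindex : ∀ (M : ℕ) (g : ℕ → R),
      ∑ x ∈ Finset.Icc 1 (M + 1), g x = ∑ j ∈ Finset.range (M + 1), g (M + 1 - j) := by
    intro M g
    refine Finset.sum_nbij' (fun x => M + 1 - x) (fun j => M + 1 - j) ?_ ?_ ?_ ?_ ?_ <;>
      simp only [Finset.mem_Icc, Finset.mem_range] <;> intro x hx
    · omega
    · omega
    · omega
    · omega
    · rw [show M + 1 - (M + 1 - x) = x by omega]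
  rw [pow_mul_pow_eq_of_mul_eq huv, reindex, reindex, Finset.mul_sum, Finset.mul_sum]
  congr 1
  · refine Finset.sum_congr rfl fun j hj => ?_
    have := Finset.mem_range.1 hj
    rw [show K + 1 + (L + 1) - (K + 1 - j) - 1 = j + L by omega,
      show K + 1 + (L + 1) - (K + 1 - j) = L + 1 + j by omega,
      show K + 1 - j = (K - j) + 1 by omega, Nat.add_sub_cancel]
    ring
  · refine Finset.sum_congr rfl fun j hj => ?_
    have := Finset.mem_range.1 hj
    rw [show K + 1 + (L + 1) - (L + 1 - j) - 1 = j + K by omega,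
      show K + 1 + (L + 1) - (L + 1 - j) = K + 1 + j by omega,
      show L + 1 - (L + 1 - j) = j by omega,
      show L + 1 - j = (L - j) + 1 by omega, Nat.add_sub_cancel, neg_pow w j]
    ring

/-- Both sides vanish at `0`, so it suffices to compare increments in `M`, where the identity is
partial fractions applied term by term. -/
theorem powSum_convSum {k n : ℕ} (hk : 1 ≤ k) (hn : 1 ≤ n) (h : ℕ → ℝ) :
    powSum k (convSum n h) =
      ∑ x ∈ Finset.Icc 1 k, ((-1) ^ n * ((k + n - x - 1).choose (n - 1) : ℝ)) •
          powSum x (powSum (k + n - x) h) +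
        ∑ x ∈ Finset.Icc 1 n, ((-1) ^ (n - x) * ((k + n - x - 1).choose (k - 1) : ℝ)) •
          convSum x (powSum (k + n - x) h) := by
  funext M
  simp only [Pi.add_apply, Finset.sum_apply, Pi.smul_apply, smul_eq_mul]
  induction M with
  | zero => simp [convSum]
  | succ M ih =>
    simp only [convSum_powSum_succ]
    rw [powSum_succ, ih]
    simp only [powSum_succ _ (powSum _ _), mul_add, Finset.sum_add_distrib]
    have key : convSum n h M * ((M : ℝ) + 1)⁻¹ ^ k =
        ∑ x ∈ Finset.Icc 1 k, (-1) ^ n * ((k + n - x - 1).choose (n - 1) : ℝ) *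
          (powSum (k + n - x) h M * ((M : ℝ) + 1)⁻¹ ^ x) +
        ∑ x ∈ Finset.Icc 1 n, (-1) ^ (n - x) * ((k + n - x - 1).choose (k - 1) : ℝ) *
          ∑ a ∈ Finset.range M, h (M - 1 - a) *
            (((M - 1 - a : ℕ) : ℝ) + 1)⁻¹ ^ (k + n - x) * ((a : ℝ) + 1)⁻¹ ^ x := by
      simp only [powSum_reflect _ h, convSum, Finset.sum_mul, Finset.mul_sum]
      rw [Finset.sum_comm, Finset.sum_comm (s := Finset.Icc 1 n), ← Finset.sum_add_distrib]
      refine Finset.sum_congr rfl fun a ha => ?_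
      have ha := Finset.mem_range.1 ha
      -- The outer variable is the sum of the two variables of the convolution; this yields the
      -- relation `huv`.
      have hM : (M : ℝ) + 1 = (((M - 1 - a : ℕ) : ℝ) + 1) + ((a : ℝ) + 1) := by
        have : M = (M - 1 - a) + 1 + a := by omega
        have : (M : ℝ) = ((M - 1 - a : ℕ) : ℝ) + 1 + a := by exact_mod_cast this
        linarith
      have huv : ((M : ℝ) + 1)⁻¹ * ((a : ℝ) + 1)⁻¹ =
          (((M - 1 - a : ℕ) : ℝ) + 1)⁻¹ * (((a : ℝ) + 1)⁻¹ - ((M : ℝ) + 1)⁻¹) := by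
        rw [hM]
        field_simp
        ring
      have := pow_mul_pow_partial_fractions huv hk hn
      rw [mul_assoc, mul_comm (_ ^ n), this, mul_add, Finset.mul_sum, Finset.mul_sum]
      congr 1 <;> refine Finset.sum_congr rfl fun x _ => ?_ <;> ring
    rw [key]
    ring

/-! ### The exact identity at a finite cut-off -/

theorem shiftedArg_update_of_lt (k n : ℕ → ℕ) {j i : ℕ} (x : ℕ) (h : j < i) :
    shiftedArg k (Function.update n j x) i = shiftedArg k n i := by
  simp [shiftedArg, Function.update_of_ne (show i ≠ j by omega),
    Function.update_of_ne (show i + 1 ≠ j by omega)]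

theorem shiftedArg_update_self (k n : ℕ → ℕ) (j x : ℕ) :
    shiftedArg k (Function.update n j x) j = k j + n (j + 1) - x := by
  simp [shiftedArg]

theorem binomProd_update_of_lt (m : ℕ) (k n : ℕ → ℕ) {j a : ℕ} (x : ℕ) (h : j < a) :
    binomProd m k (Function.update n j x) a = binomProd m k n a := by
  refine Finset.prod_congr rfl fun i hi => ?_
  rw [shiftedArg_update_of_lt k n x (by have := Finset.mem_Ico.1 hi; omega)]

theorem binomProd_eq_mul {m : ℕ} (k n : ℕ → ℕ) {a : ℕ} (h : a < m) :
    binomProd m k n a = ((shiftedArg k n a - 1).choose (k a - 1) : ℝ) * binomProd m k n (a + 1) :=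
  Finset.prod_eq_prod_Ico_succ_bot h _

theorem mzvCut_boundaryArgs {m j : ℕ} (k n : ℕ → ℕ) (N : ℕ) (h : j + 2 ≤ m) :
    mzvCut N m (boundaryArgs k n (j + 1)) =
      iterSum k 1 j (powSum (n (j + 1)) (powSum (shiftedArg k n (j + 1))
        (iterSum (shiftedArg k n) (j + 2) (m - (j + 2)) 1))) N := by
  obtain ⟨d, rfl⟩ := Nat.exists_eq_add_of_le h
  rw [mzvCut_eq_iterSum, show j + 2 + d = j + (d + 1 + 1) by ring, iterSum_add_length]
  have e1 : ∀ f, iterSum (boundaryArgs k n (j + 1)) 1 j f = iterSum k 1 j f := fun f =>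
    iterSum_congr f fun i hi => by simp [boundaryArgs, show 1 + i < j + 1 by omega]
  have e2 : iterSum (boundaryArgs k n (j + 1)) (1 + j + 1 + 1) d 1 =
      iterSum (shiftedArg k n) (j + 2) d 1 := iterSum_congr 1 fun i hi => by
    simp only [boundaryArgs]
    rw [if_neg (by omega), if_neg (by omega)]
    congr 1
    omega
  rw [e1]
  simp only [iterSum]
  rw [e2, show j + (d + 1 + 1) - (j + 2) = d by omega]
  simp [boundaryArgs, add_comm 1 j]

/-- The summand of the nested sum in `boundarySum`. -/
noncomputable def boundaryTerm (Z : ℕ → (ℕ → ℕ) → ℝ) (m : ℕ) (k : ℕ → ℕ) (j l : ℕ)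
    (n' : ℕ → ℕ) : ℝ :=
  ∑ x ∈ Finset.Icc l (k j),
    let n := Function.update n' j x
    binomProd m k n (j + 1) * ((shiftedArg k n j - 1).choose (n (j + 1) - 1) : ℝ) *
      Z m (boundaryArgs k n j)

theorem boundarySum_eq (Z : ℕ → (ℕ → ℕ) → ℝ) (m : ℕ) (k : ℕ → ℕ) (j l : ℕ) :
    boundarySum Z m k j l =
      (-1) ^ k m * nestedSum (boundaryTerm Z m k j l) (j + 1) (m - 1 - j) k := rfl

/-- The contribution of `n = (n₁, …, n_m)` to the last sum of the cut-off identity, the product of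
two cut-off sums being replaced by a convolution. -/
noncomputable def convTerm (N m : ℕ) (k n : ℕ → ℕ) : ℝ :=
  (-1) ^ (k m - n 1) * binomProd m k n 1 *
    convSum (n 1) (iterSum (shiftedArg k n) 1 (m - 1) 1) N

/-- The state of the recursion with `j` operators still outside the convolution and `n_{j+1}, …,
n_m` already chosen. Absorbing `k_j` produces the boundary terms of index `j` and, for each choice
of `n_j`, the same state with one operator fewer. -/
theorem iterSum_convSum_eq {m : ℕ} {k : ℕ → ℕ} (hk : ∀ i ∈ Finset.Icc 1 m, 1 ≤ k i) (N : ℕ) {j : ℕ}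
    (hj : j + 1 ≤ m) (n : ℕ → ℕ) (hn : 1 ≤ n (j + 1)) (hnm : n (j + 1) ≤ k m) :
    (-1) ^ (k m - n (j + 1)) * binomProd m k n (j + 1) *
        iterSum k 1 j (convSum (n (j + 1))
          (iterSum (shiftedArg k n) (j + 1) (m - (j + 1)) 1)) N =
      ∑ i ∈ Finset.Icc 1 j,
          (-1) ^ k m * nestedSum (boundaryTerm (mzvCut N) m k i 1) (i + 1) (j - i) n +
        nestedSum (convTerm N m k) 1 j n := by
  induction j generalizing n with
  | zero => simp [nestedSum, convTerm, iterSum]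
  | succ j ih =>
    have hkj : 1 ≤ k (j + 1) := hk _ (Finset.mem_Icc.2 ⟨by omega, by omega⟩)
    rw [iterSum_succ_last, add_comm 1 j, powSum_convSum hkj hn, iterSum_add, iterSum_sum,
      iterSum_sum]
    simp only [iterSum_smul, Pi.add_apply, Finset.sum_apply, Pi.smul_apply, smul_eq_mul]
    rw [mul_add, Finset.sum_Icc_succ_top (by omega)]
    have split : ∀ {a b c d e : ℝ}, a = c → b = d + e → a + b = d + c + e := fun h h' => by
      rw [h, h']; ring
    refine split ?_ ?_
    · rw [Nat.sub_self, nestedSum, boundaryTerm, Finset.mul_sum, Finset.mul_sum]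
      refine Finset.sum_congr rfl fun x hx => ?_
      dsimp only
      rw [mzvCut_boundaryArgs _ _ _ (by omega), binomProd_update_of_lt m k n x (by omega),
        shiftedArg_update_self, Function.update_self,
        Function.update_of_ne (show j + 1 + 1 ≠ j + 1 by omega),
        iterSum_congr (s := shiftedArg k (Function.update n (j + 1) x)) (t := shiftedArg k n)
          (b := j + 2) 1 fun i _ => shiftedArg_update_of_lt k n x (by omega)]
      -- The bound `hnm` makes this natural subtraction genuine, so the signs multiply to `(-1) ^ k
      -- m`.
      rw [show k m = (k m - n (j + 1 + 1)) + n (j + 1 + 1) by omega, pow_add,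
        Nat.add_sub_cancel]
      ring
    · have nest : ∀ (F : (ℕ → ℕ) → ℝ) (i : ℕ), i ≤ j →
          nestedSum F (i + 1) (j + 1 - i) n = ∑ x ∈ Finset.Icc 1 (n (j + 1 + 1)),
            nestedSum F (i + 1) (j - i) (Function.update n (j + 1) x) := by
        intro F i hi
        rw [show j + 1 - i = (j - i) + 1 by omega, nestedSum,
          show i + 1 + (j - i) = j + 1 by omega]
      have nest' := Finset.sum_congr (rfl : Finset.Icc 1 j = _) fun i hi =>
        congrArg ((-1) ^ k m * ·)
          (nest (boundaryTerm (mzvCut N) m k i 1) i (Finset.mem_Icc.1 hi).2)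
      rw [nest']
      rw [show nestedSum (convTerm N m k) 1 (j + 1) n = _ from nest _ 0 (by omega)]
      simp only [Finset.mul_sum]
      rw [Finset.sum_comm, ← Finset.sum_add_distrib]
      refine Finset.sum_congr rfl fun x hx => ?_
      have hx := Finset.mem_Icc.1 hx
      have := ih (by omega) (Function.update n (j + 1) x) (by simpa using hx.1)
        (by simp; omega)
      simp only [zero_add, Nat.sub_zero]
      rw [← Finset.mul_sum] at this ⊢
      rw [← this, binomProd_eq_mul k _ (show j + 1 < m by omega),
        binomProd_update_of_lt m k n x (by omega), Function.update_self,
        show m - (j + 1) = (m - (j + 1 + 1)) + 1 by omega]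
      simp only [iterSum]
      rw [shiftedArg_update_self,
        iterSum_congr (s := shiftedArg k (Function.update n (j + 1) x)) (t := shiftedArg k n)
          (b := j + 1 + 1) 1 fun i _ => shiftedArg_update_of_lt k n x (by omega)]
      rw [show k m - x = (k m - n (j + 1 + 1)) + (n (j + 1 + 1) - x) by omega, pow_add]
      ring

/-- The initial state of the recursion, `j = m - 1` and `n = k`: the sign is `1`, the binomial
product is empty, and the convolution is `powSum (k m) 1`. -/
theorem mzvCut_eq_sum_boundarySum {m : ℕ} {k : ℕ → ℕ} (hm : 1 ≤ m)
    (hk : ∀ i ∈ Finset.Icc 1 m, 1 ≤ k i) (N : ℕ) :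
    mzvCut N m k = ∑ j ∈ Finset.Icc 1 (m - 1), boundarySum (mzvCut N) m k j 1 +
      nestedSum (convTerm N m k) 1 (m - 1) k := by
  obtain ⟨d, rfl⟩ := Nat.exists_eq_add_of_le' hm
  have := iterSum_convSum_eq hk N (le_refl (d + 1)) k
    (hk _ (Finset.mem_Icc.2 ⟨by omega, le_rfl⟩)) le_rfl
  simp only [binomProd, Nat.sub_self, Finset.Ico_self, Finset.prod_empty, pow_zero, one_mul,
    iterSum, convSum_one] at this
  simp only [boundarySum_eq, Nat.add_sub_cancel]
  rw [← this, mzvCut_eq_iterSum, iterSum_succ_last, add_comm 1 d]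

/-! ### Calculus of nested sums -/

/-- The definition peels off the outermost variable; isolating the terms with `n_1 = 1` needs the
innermost one. -/
theorem nestedSum_succ_first (F : (ℕ → ℕ) → ℝ) (a c : ℕ) (n : ℕ → ℕ) :
    nestedSum F a (c + 1) n =
      nestedSum (fun n' => ∑ x ∈ Finset.Icc 1 (n' (a + 1)), F (Function.update n' a x))
        (a + 1) c n := by
  induction c generalizing n with
  | zero => simp [nestedSum]
  | succ c ih =>
    rw [nestedSum, nestedSum]
    simp only [show a + (c + 1) = a + 1 + c by ring]
    exact Finset.sum_congr rfl fun x _ => ih _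

/-- The index functions `n` that occur in `nestedSum F a c n₀`. -/
def NestedIndex (a c : ℕ) (n₀ n : ℕ → ℕ) : Prop :=
  (∀ i, a + c ≤ i → n i = n₀ i) ∧ ∀ i, a ≤ i → i < a + c → 1 ≤ n i ∧ n i ≤ n (i + 1)

theorem NestedIndex.of_update {a c : ℕ} {n₀ n : ℕ → ℕ} {x : ℕ}
    (hx : x ∈ Finset.Icc 1 (n₀ (a + c + 1)))
    (h : NestedIndex a c (Function.update n₀ (a + c) x) n) : NestedIndex a (c + 1) n₀ n := by
  have hx := Finset.mem_Icc.1 hx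
  have h0 : ∀ i, a + c < i → n i = n₀ i := fun i hi => by
    rw [h.1 i hi.le, Function.update_of_ne hi.ne']
  refine ⟨fun i hi => h0 i (by omega), fun i hi hi' => ?_⟩
  rcases (show i < a + c ∨ i = a + c by omega) with hlt | rfl
  · exact h.2 i hi hlt
  · rw [h.1 _ le_rfl, Function.update_self, h0 _ (by omega)]
    exact hx

theorem nestedSum_congr {F G : (ℕ → ℕ) → ℝ} {a c : ℕ} {n₀ : ℕ → ℕ}
    (h : ∀ n, NestedIndex a c n₀ n → F n = G n) : nestedSum F a c n₀ = nestedSum G a c n₀ := by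
  induction c generalizing n₀ with
  | zero => exact h _ ⟨fun _ _ => rfl, fun i hi hi' => absurd hi' (by omega)⟩
  | succ c ih => exact Finset.sum_congr rfl fun x hx => ih fun n hn => h n (hn.of_update hx)

theorem tendsto_nestedSum {F : ℕ → (ℕ → ℕ) → ℝ} {L : (ℕ → ℕ) → ℝ} {a c : ℕ} {n₀ : ℕ → ℕ}
    (h : ∀ n, NestedIndex a c n₀ n → Tendsto (fun N => F N n) atTop (𝓝 (L n))) :
    Tendsto (fun N => nestedSum (F N) a c n₀) atTop (𝓝 (nestedSum L a c n₀)) := by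
  induction c generalizing n₀ with
  | zero => exact h _ ⟨fun _ _ => rfl, fun i hi hi' => absurd hi' (by omega)⟩
  | succ c ih => exact tendsto_finsetSum _ fun x hx => ih fun n hn => h n (hn.of_update hx)

theorem nestedSum_add (F G : (ℕ → ℕ) → ℝ) (a c : ℕ) (n : ℕ → ℕ) :
    nestedSum (fun n => F n + G n) a c n = nestedSum F a c n + nestedSum G a c n := by
  induction c generalizing n with
  | zero => rfl
  | succ c ih => simp only [nestedSum, ih, Finset.sum_add_distrib]

theorem nestedSum_const_mul (r : ℝ) (F : (ℕ → ℕ) → ℝ) (a c : ℕ) (n : ℕ → ℕ) :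
    nestedSum (fun n => r * F n) a c n = r * nestedSum F a c n := by
  induction c generalizing n with
  | zero => rfl
  | succ c ih => simp only [nestedSum, ih, Finset.mul_sum]

/-! ### Harmonic bounds and convergence -/

theorem powSum_nonneg (e : ℕ) {f : ℕ → ℝ} (hf : ∀ i, 0 ≤ f i) (N : ℕ) : 0 ≤ powSum e f N :=
  Finset.sum_nonneg fun i _ => mul_nonneg (hf i) (by positivity)

theorem iterSum_one_nonneg (s : ℕ → ℕ) (a c N : ℕ) : 0 ≤ iterSum s a c 1 N := by
  induction c generalizing a N with
  | zero => exact zero_le_one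
  | succ c ih => exact powSum_nonneg _ (ih _) N

theorem powSum_one_mono : Monotone (powSum 1 1) :=
  monotone_nat_of_le_succ fun N => by
    rw [powSum_succ]
    have : (0 : ℝ) ≤ ((N : ℝ) + 1)⁻¹ := by positivity
    simpa using this

theorem inv_pow_le_inv_pow {e f : ℕ} (h : e ≤ f) (i : ℕ) :
    ((i : ℝ) + 1)⁻¹ ^ f ≤ ((i : ℝ) + 1)⁻¹ ^ e :=
  pow_le_pow_of_le_one (by positivity) (inv_le_one_of_one_le₀ (by simp)) h

/-- Lowering every exponent to `1` and letting each variable run freely up to `N` leaves a power of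
the harmonic number. -/
theorem iterSum_one_le (s : ℕ → ℕ) (a c N : ℕ) (hs : ∀ i < c, 1 ≤ s (a + i)) :
    iterSum s a c 1 N ≤ powSum 1 1 N ^ c := by
  induction c generalizing a N with
  | zero => simp [iterSum]
  | succ c ih =>
    rw [iterSum, pow_succ']
    refine le_of_le_of_eq ?_ (Finset.sum_mul _ _ _).symm
    refine Finset.sum_le_sum fun i hi => ?_
    have h1 := ih (a + 1) i fun j hj => by
      simpa [add_assoc, add_comm 1 j] using hs (j + 1) (by omega)
    have h2 : powSum 1 1 i ^ c ≤ powSum 1 1 N ^ c :=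
      pow_le_pow_left₀ (powSum_nonneg _ (fun _ => zero_le_one) _)
        (powSum_one_mono (Finset.mem_range.1 hi).le) _
    have h3 := inv_pow_le_inv_pow (hs 0 (by omega)) i
    have h4 : (0 : ℝ) ≤ ((i : ℝ) + 1)⁻¹ := by positivity
    rw [mul_comm]
    simp only [Pi.one_apply, one_mul]
    exact mul_le_mul h3 (h1.trans h2) (iterSum_one_nonneg _ _ _ _) (by positivity)

theorem powSum_one_eq_harmonic (N : ℕ) : powSum 1 1 N = (harmonic N : ℝ) := by
  simp [powSum, harmonic]

/-- Powers of harmonic numbers are `O(n ^ (1/2))`, so the terms are `O(n ^ (-3/2))`. This series is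
the common majorant for convergence and for dominated convergence. -/
theorem summable_powSum_pow (c : ℕ) :
    Summable fun i : ℕ => powSum 1 1 (i + 1) ^ c * ((i : ℝ) + 1)⁻¹ ^ 2 := by
  have hlog : (fun x : ℝ => (1 + Real.log x) ^ c) =O[atTop] fun x => x ^ (1 / 2 : ℝ) := by
    have h1 : (fun x : ℝ => 1 + Real.log x) =O[atTop] Real.log := by
      refine Asymptotics.IsBigO.add ?_ (Asymptotics.isBigO_refl _ _)
      exact (Real.isLittleO_const_log_atTop (c := 1)).isBigO
    refine (h1.pow c).trans ?_
    have := (isLittleO_log_rpow_rpow_atTop (c : ℝ) (show (0 : ℝ) < 1 / 2 by norm_num)).isBigO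
    simpa [Real.rpow_natCast] using this
  have hmain : (fun n : ℕ => powSum 1 1 n ^ c * ((n : ℝ))⁻¹ ^ 2) =O[atTop]
      fun n : ℕ => (n : ℝ) ^ (-(3 / 2) : ℝ) := by
    have h2 : (fun n : ℕ => powSum 1 1 n ^ c * ((n : ℝ))⁻¹ ^ 2) =O[atTop]
        fun n : ℕ => (1 + Real.log n) ^ c * ((n : ℝ))⁻¹ ^ 2 := by
      refine Asymptotics.IsBigO.of_bound 1 (Eventually.of_forall fun n => ?_)
      rw [one_mul, norm_mul, norm_mul]
      gcongr
      have h0 : 0 ≤ powSum 1 1 n := powSum_nonneg _ (fun _ => zero_le_one) _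
      rw [Real.norm_of_nonneg (pow_nonneg h0 c)]
      refine le_trans ?_ (le_abs_self _)
      refine pow_le_pow_left₀ h0 ?_ c
      rw [powSum_one_eq_harmonic]
      exact harmonic_le_one_add_log n
    refine h2.trans ?_
    refine ((hlog.comp_tendsto tendsto_natCast_atTop_atTop).mul
      (Asymptotics.isBigO_refl (fun n : ℕ => ((n : ℝ))⁻¹ ^ 2) atTop)).trans_eventuallyEq ?_
    filter_upwards [eventually_gt_atTop 0] with n hn
    have hn : (0 : ℝ) < n := by exact_mod_cast hn
    simp only [Function.comp]
    rw [← Real.rpow_natCast, Real.inv_rpow hn.le, ← Real.rpow_neg hn.le, ← Real.rpow_add hn]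
    norm_num
  have := summable_of_isBigO_nat (Real.summable_nat_rpow.2 (by norm_num : -(3 / 2 : ℝ) < -1)) hmain
  simpa using (summable_nat_add_iff 1).2 this

theorem MZVAdmissible.one_le {r : ℕ} {s : ℕ → ℕ} (hs : MZVAdmissible r s) {a : ℕ} (ha : 1 ≤ a) :
    ∀ i < r + 1 - a, 1 ≤ s (a + i) := fun i hi =>
  hs.2 _ (Finset.mem_Icc.2 ⟨by omega, by omega⟩)

theorem iterSum_two_mul_le {r : ℕ} {s : ℕ → ℕ} (hs : MZVAdmissible (r + 1) s) (i : ℕ) :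
    iterSum s 2 r 1 i * ((i : ℝ) + 1)⁻¹ ^ s 1 ≤
      powSum 1 1 (i + 1) ^ r * ((i : ℝ) + 1)⁻¹ ^ 2 := by
  refine mul_le_mul ?_ (inv_pow_le_inv_pow hs.1 i) (by positivity)
    (pow_nonneg (powSum_nonneg _ (fun _ => zero_le_one) _) _)
  refine (iterSum_one_le s 2 r i fun j hj => hs.one_le (by norm_num) j (by omega)).trans ?_
  exact pow_le_pow_left₀ (powSum_nonneg _ (fun _ => zero_le_one) _) (powSum_one_mono (by omega)) _

theorem iterSum_two_mul_nonneg (r : ℕ) (s : ℕ → ℕ) (i : ℕ) :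
    0 ≤ iterSum s 2 r 1 i * ((i : ℝ) + 1)⁻¹ ^ s 1 :=
  mul_nonneg (iterSum_one_nonneg _ _ _ _) (by positivity)

theorem mzvCut_le {r : ℕ} {s : ℕ → ℕ} (hs : MZVAdmissible (r + 1) s) (N : ℕ) :
    mzvCut N (r + 1) s ≤ ∑' i : ℕ, powSum 1 1 (i + 1) ^ r * ((i : ℝ) + 1)⁻¹ ^ 2 := by
  rw [mzvCut_eq_iterSum, iterSum, powSum]
  refine (Finset.sum_le_sum fun i _ => iterSum_two_mul_le hs i).trans ?_
  refine (summable_powSum_pow r).sum_le_tsum _ fun i _ => mul_nonneg ?_ (by positivity)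
  exact pow_nonneg (powSum_nonneg _ (fun _ => zero_le_one) _) _

theorem mzvTerm_nonneg (m : ℕ) (s : ℕ → ℕ) (n : Fin m → ℕ) : 0 ≤ mzvTerm m s n :=
  div_nonneg zero_le_one (Finset.prod_nonneg fun _ _ => by positivity)

open Classical in
/-- The indices that occur in the cut-off sum `mzvCut N m`. -/
noncomputable def mzvIndexCut (N m : ℕ) : Finset (MZVIndex m) :=
  ((Fintype.piFinset fun _ : Fin m => Finset.Icc 1 N).filter StrictAnti).subtype
    fun n => StrictAnti n ∧ ∀ i, 0 < n i

theorem mem_mzvIndexCut {N m : ℕ} {n : MZVIndex m} : n ∈ mzvIndexCut N m ↔ ∀ i, n.val i ≤ N := by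
  have h1 := n.2.1
  have h2 := n.2.2
  refine Finset.mem_subtype.trans ?_
  simp only [Finset.mem_filter, Fintype.mem_piFinset, Finset.mem_Icc]
  exact ⟨fun h i => (h.1 i).2, fun h => ⟨fun i => ⟨h2 i, h i⟩, h1⟩⟩

theorem sum_mzvIndexCut (N m : ℕ) (s : ℕ → ℕ) :
    ∑ n ∈ mzvIndexCut N m, mzvTerm m s n.val = mzvCut N m s := by
  classical
  rw [mzvIndexCut, mzvCut]
  refine Finset.sum_subtype_of_mem (mzvTerm m s) fun n hn => ?_
  simp only [Finset.mem_filter, Fintype.mem_piFinset, Finset.mem_Icc] at hn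
  exact ⟨hn.2, fun i => (hn.1 i).1⟩

theorem tendsto_mzvIndexCut (m : ℕ) : Tendsto (fun N => mzvIndexCut N m) atTop atTop := by
  refine tendsto_atTop_finset_of_monotone (fun N M hNM n hn => ?_) fun n => ?_
  · exact mem_mzvIndexCut.2 fun i => (mem_mzvIndexCut.1 hn i).trans hNM
  -- The sum of the entries bounds each of them.
  · exact ⟨∑ i, n.val i, mem_mzvIndexCut.2 fun i =>
      Finset.single_le_sum (f := n.val) (fun _ _ => Nat.zero_le _) (Finset.mem_univ i)⟩

/-- The terms are nonnegative, and every finite set of indices lies in a cut-off, where the sum is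
uniformly bounded. -/
theorem summable_mzvTerm {r : ℕ} {s : ℕ → ℕ} (hr : 1 ≤ r) (hs : MZVAdmissible r s) :
    Summable fun n : MZVIndex r => mzvTerm r s n.val := by
  obtain ⟨r, rfl⟩ := Nat.exists_eq_add_of_le' hr
  refine summable_of_sum_le (fun n => mzvTerm_nonneg _ _ _) (fun t => ?_)
    (c := ∑' i : ℕ, powSum 1 1 (i + 1) ^ r * ((i : ℝ) + 1)⁻¹ ^ 2)
  obtain ⟨N, hN⟩ := ((tendsto_mzvIndexCut (r + 1)).eventually_ge_atTop t).exists
  refine (Finset.sum_le_sum_of_subset_of_nonneg hN fun n _ _ => mzvTerm_nonneg _ _ _).trans ?_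
  rw [sum_mzvIndexCut]
  exact mzvCut_le hs N

theorem tendsto_mzvCut {r : ℕ} {s : ℕ → ℕ} (hr : 1 ≤ r) (hs : MZVAdmissible r s) :
    Tendsto (fun N => mzvCut N r s) atTop (𝓝 (mzv r s)) := by
  have := (summable_mzvTerm hr hs).hasSum.comp (tendsto_mzvIndexCut r)
  simp only [Function.comp_def, sum_mzvIndexCut] at this
  exact this

/-! ### The stuffle product with `ζ_N(1)` -/

/-- The new variable is larger than, equal to, or smaller than the leading variable of the other
factor. -/
theorem powSum_one_mul_powSum (e : ℕ) (f : ℕ → ℝ) :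
    powSum 1 1 * powSum e f =
      powSum 1 (powSum e f) + (powSum (e + 1) f + powSum e (powSum 1 1 * f)) := by
  funext N
  simp only [Pi.mul_apply, Pi.add_apply]
  induction N with
  | zero => simp
  | succ N ih =>
    simp only [powSum_succ, Pi.mul_apply, Pi.one_apply]
    linear_combination ih

theorem powSum_one_mul_iterSum (s : ℕ → ℕ) (a c : ℕ) :
    powSum 1 1 * iterSum s a c 1 =
      powSum 1 (iterSum s a c 1) + ∑ κ ∈ Finset.Ico a (a + c),
        (iterSum (raiseAt s κ) a c 1 + iterSum (insertOneAfter s κ) a (c + 1) 1) := by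
  induction c generalizing a with
  | zero => simp [iterSum]
  | succ c ih =>
    rw [iterSum, powSum_one_mul_powSum, ih (a + 1), powSum_add, powSum_sum,
      Finset.sum_eq_sum_Ico_succ_bot (by omega : a < a + (c + 1)),
      show a + 1 + c = a + (c + 1) by ring]
    have e1 : iterSum (raiseAt s a) a (c + 1) 1 = powSum (s a + 1) (iterSum s (a + 1) c 1) := by
      rw [iterSum, iterSum_congr (t := s) (b := a + 1) 1 fun i _ => by
        simp [raiseAt, show a + 1 + i ≠ a by omega]]
      simp [raiseAt]
    have e2 : iterSum (insertOneAfter s a) a (c + 1 + 1) 1 =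
        powSum (s a) (powSum 1 (iterSum s (a + 1) c 1)) := by
      rw [iterSum, iterSum, iterSum_congr (t := s) (b := a + 1) 1 fun i _ => by
        simp only [insertOneAfter]
        rw [if_neg (by omega), if_neg (by omega)]
        congr 1
        omega]
      simp [insertOneAfter]
    have e3 : ∀ κ ∈ Finset.Ico (a + 1) (a + (c + 1)),
        iterSum (raiseAt s κ) a (c + 1) 1 + iterSum (insertOneAfter s κ) a (c + 1 + 1) 1 =
          powSum (s a) (iterSum (raiseAt s κ) (a + 1) c 1 +
            iterSum (insertOneAfter s κ) (a + 1) (c + 1) 1) := fun κ hκ => by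
      have := Finset.mem_Ico.1 hκ
      rw [powSum_add, iterSum, iterSum]
      simp [raiseAt, insertOneAfter, show a ≠ κ by omega, show a ≤ κ by omega]
    rw [e1, e2, Finset.sum_congr rfl e3]
    ring

theorem mzvCut_one_mul_sub (N r : ℕ) (s : ℕ → ℕ) :
    mzvCut N 1 (fun _ => 1) * mzvCut N r s - mzvCut N (r + 1) (consOne s) =
      ∑ κ ∈ Finset.Icc 1 r,
        (mzvCut N r (raiseAt s κ) + mzvCut N (r + 1) (insertOneAfter s κ)) := by
  have h := congrFun (powSum_one_mul_iterSum s 1 r) N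
  have hc : iterSum (consOne s) 1 (r + 1) 1 = powSum 1 (iterSum s 1 r 1) := by
    rw [iterSum, iterSum_congr (t := s) (b := 1) 1 fun i _ => by
      simp only [consOne]
      rw [if_neg (by omega)]
      congr 1
      omega]
    simp [consOne]
  rw [mzvCut_one]
  simp only [mzvCut_eq_iterSum, hc]
  simp only [Pi.mul_apply, Pi.add_apply, Finset.sum_apply] at h
  rw [h, add_sub_cancel_left, add_comm 1 r]
  rfl

theorem MZVAdmissible.raiseAt {r : ℕ} {s : ℕ → ℕ} (hs : MZVAdmissible r s) (κ : ℕ) :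
    MZVAdmissible r (raiseAt s κ) := by
  have h : ∀ i, s i ≤ _root_.raiseAt s κ i := fun i => by
    unfold _root_.raiseAt
    split_ifs <;> omega
  exact ⟨hs.1.trans (h 1), fun i hi => (hs.2 i hi).trans (h i)⟩

theorem MZVAdmissible.insertOneAfter {r : ℕ} {s : ℕ → ℕ} (hs : MZVAdmissible r s) {κ : ℕ}
    (hκ : 1 ≤ κ) (hκr : κ ≤ r) : MZVAdmissible (r + 1) (insertOneAfter s κ) := by
  refine ⟨by simpa [_root_.insertOneAfter, hκ] using hs.1, fun i hi => ?_⟩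
  have hi := Finset.mem_Icc.1 hi
  unfold _root_.insertOneAfter
  split_ifs with h1 h2
  · exact hs.2 i (Finset.mem_Icc.2 ⟨hi.1, by omega⟩)
  · exact le_rfl
  · exact hs.2 _ (Finset.mem_Icc.2 ⟨by omega, by omega⟩)

theorem tendsto_mzvCut_one_mul_sub {r : ℕ} {s : ℕ → ℕ} (hr : 1 ≤ r) (hs : MZVAdmissible r s) :
    Tendsto (fun N : ℕ => mzvCut N 1 (fun _ => 1) * mzvCut N r s - mzvCut N (r + 1) (consOne s))
      atTop (𝓝 (reflSum r s)) := by
  simp only [mzvCut_one_mul_sub]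
  refine tendsto_finsetSum _ fun κ hκ => ?_
  have hκ := Finset.mem_Icc.1 hκ
  exact (tendsto_mzvCut hr (hs.raiseAt κ)).add
    (tendsto_mzvCut (by omega) (hs.insertOneAfter hκ.1 hκ.2))

/-! ### Product versus convolution -/

/-- The difference is the sum over the square minus the triangle. For fixed `p`, the other variable
runs through the last `p + 1` values below the cut-off. -/
theorem powSum_mul_sub_convSum (n : ℕ) (c : ℕ → ℝ) (N : ℕ) :
    powSum n 1 N * ∑ p ∈ Finset.range N, c p - convSum n (fun M => ∑ p ∈ Finset.range M, c p) N =
      ∑ p ∈ Finset.range N, c p *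
        ∑ b ∈ Finset.range (p + 1), (((N - 1 - p + b : ℕ) : ℝ) + 1)⁻¹ ^ n := by
  have h1 : ∀ p ∈ Finset.range N,
      ∑ b ∈ Finset.range (p + 1), (((N - 1 - p + b : ℕ) : ℝ) + 1)⁻¹ ^ n =
        ∑ a ∈ Finset.Ico (N - 1 - p) N, ((a : ℝ) + 1)⁻¹ ^ n := fun p hp => by
    have := Finset.mem_range.1 hp
    rw [Finset.sum_Ico_eq_sum_range, show N - (N - 1 - p) = p + 1 by omega]
  have h2 : ∀ a ∈ Finset.range N,
      (∑ p ∈ Finset.range N, c p) - ∑ p ∈ Finset.range (N - 1 - a), c p =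
        ∑ p ∈ Finset.Ico (N - 1 - a) N, c p := fun a _ =>
    (Finset.sum_Ico_eq_sub _ (by omega)).symm
  have h4 := Finset.sum_congr (rfl : Finset.range N = _) fun p hp => congrArg (c p * ·) (h1 p hp)
  rw [h4]
  rw [powSum, convSum, Finset.sum_mul, ← Finset.sum_sub_distrib]
  have h3 : ∀ a ∈ Finset.range N,
      (1 : ℕ → ℝ) a * ((a : ℝ) + 1)⁻¹ ^ n * ∑ p ∈ Finset.range N, c p -
        (∑ p ∈ Finset.range (N - 1 - a), c p) * ((a : ℝ) + 1)⁻¹ ^ n =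
      ∑ p ∈ Finset.Ico (N - 1 - a) N, c p * ((a : ℝ) + 1)⁻¹ ^ n := fun a ha => by
    rw [← Finset.sum_mul, ← h2 a ha, Pi.one_apply]
    ring
  rw [Finset.sum_congr rfl h3]
  simp only [Finset.mul_sum]
  refine Finset.sum_comm' ?_
  intro a p
  simp only [Finset.mem_range, Finset.mem_Ico]
  omega

theorem tendsto_mul_sub_convSum {r n : ℕ} {s : ℕ → ℕ} (hn : 1 ≤ n)
    (hs : MZVAdmissible (r + 1) s) :
    Tendsto (fun N => mzvCut N 1 (fun _ => n) * mzvCut N (r + 1) s -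
      convSum n (iterSum s 1 (r + 1) 1) N) atTop (𝓝 0) := by
  let c : ℕ → ℝ := fun i => iterSum s 2 r 1 i * ((i : ℝ) + 1)⁻¹ ^ s 1
  let D : ℕ → ℕ → ℝ := fun N p =>
    ∑ b ∈ Finset.range (p + 1), (((N - 1 - p + b : ℕ) : ℝ) + 1)⁻¹ ^ n
  have hc0 : ∀ p, 0 ≤ c p := iterSum_two_mul_nonneg r s
  have hD0 : ∀ N p, 0 ≤ D N p := fun N p => Finset.sum_nonneg fun b _ => by positivity
  -- Since `N - 1 - p + b ≥ b` even when the subtraction truncates, the bound is uniform in `N`.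
  have hD : ∀ N p, D N p ≤ powSum 1 1 (p + 1) := fun N p => by
    refine Finset.sum_le_sum fun b _ => ?_
    rw [Pi.one_apply, one_mul]
    refine (inv_pow_le_inv_pow hn _).trans ?_
    rw [pow_one, pow_one]
    refine inv_anti₀ (by positivity) ?_
    push_cast
    linarith [Nat.cast_nonneg (α := ℝ) (N - 1 - p)]
  have hDlim : ∀ p, Tendsto (fun N => D N p) atTop (𝓝 0) := fun p => by
    rw [show (0 : ℝ) = ∑ b ∈ Finset.range (p + 1), 0 by simp]
    refine tendsto_finsetSum _ fun b _ => ?_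
    have h1 : Tendsto (fun N : ℕ => N - 1 - p + b) atTop atTop :=
      tendsto_atTop_mono (fun N => Nat.le_add_right _ b)
        ((tendsto_sub_atTop_nat p).comp (tendsto_sub_atTop_nat 1))
    have h2 : Tendsto (fun x : ℕ => ((x : ℝ) + 1)⁻¹) atTop (𝓝 0) :=
      tendsto_inv_atTop_zero.comp
        (tendsto_atTop_add_const_right _ _ tendsto_natCast_atTop_atTop)
    simpa [show n ≠ 0 by omega] using (h2.comp h1).pow n
  have key : ∀ N, mzvCut N 1 (fun _ => n) * mzvCut N (r + 1) s -
      convSum n (iterSum s 1 (r + 1) 1) N = ∑' p, if p < N then c p * D N p else 0 := fun N => by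
    rw [mzvCut_one, mzvCut_eq_iterSum, tsum_eq_sum (s := Finset.range N) fun p hp => by
      rw [if_neg (by simpa using hp)]]
    refine (powSum_mul_sub_convSum n c N).trans (Finset.sum_congr rfl fun p hp => ?_)
    rw [if_pos (Finset.mem_range.1 hp)]
  simp only [key]
  suffices h : Tendsto (fun N => ∑' p, if p < N then c p * D N p else 0) atTop
      (𝓝 (∑' _ : ℕ, (0 : ℝ))) by rwa [tsum_zero] at h
  -- The bound on `D` costs one more harmonic factor, hence the exponent `r + 1`.
  refine tendsto_tsum_of_dominated_convergence (summable_powSum_pow (r + 1)) (fun p => ?_)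
    (Eventually.of_forall fun N p => ?_)
  · refine Tendsto.congr' (f₁ := fun N => c p * D N p) ?_ (by simpa using (hDlim p).const_mul (c p))
    filter_upwards [eventually_gt_atTop p] with N hN
    rw [if_pos hN]
  · have hH : 0 ≤ powSum 1 1 (p + 1) := powSum_nonneg _ (fun _ => zero_le_one) _
    have hle : c p * D N p ≤ powSum 1 1 (p + 1) ^ (r + 1) * ((p : ℝ) + 1)⁻¹ ^ 2 := by
      calc c p * D N p ≤ (powSum 1 1 (p + 1) ^ r * ((p : ℝ) + 1)⁻¹ ^ 2) * powSum 1 1 (p + 1) :=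
            mul_le_mul (iterSum_two_mul_le hs p) (hD N p) (hD0 N p) (by positivity)
        _ = _ := by ring
    split_ifs
    · rwa [Real.norm_of_nonneg (mul_nonneg (hc0 p) (hD0 N p))]
    · rw [norm_zero]
      positivity

/-! ### Admissible arguments and the limit of the identity -/

/-- The summand of the nested sum in `productSum`, as a function of `n = (n₁, …, n_m)`. -/
noncomputable def productTerm (Z : ℕ → (ℕ → ℕ) → ℝ) (m : ℕ) (k n : ℕ → ℕ) : ℝ :=
  (-1) ^ (k m - n 1) * binomProd m k n 1 * (Z 1 (fun _ => n 1) * Z (m - 1) (shiftedArg k n))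

theorem productSum_eq (Z : ℕ → (ℕ → ℕ) → ℝ) (m : ℕ) (k : ℕ → ℕ) (l : ℕ) :
    productSum Z m k l =
      nestedSum (fun n' => ∑ x ∈ Finset.Icc l (n' 2), productTerm Z m k (Function.update n' 1 x))
        2 (m - 2) k := rfl

theorem productSum_one_eq (Z : ℕ → (ℕ → ℕ) → ℝ) {m : ℕ} (hm : 2 ≤ m) (k : ℕ → ℕ) :
    productSum Z m k 1 = nestedSum (productTerm Z m k) 1 (m - 1) k := by
  rw [productSum_eq, show m - 1 = (m - 2) + 1 by omega, nestedSum_succ_first]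

theorem NestedIndex.one_le_apply {a c : ℕ} {n₀ n : ℕ → ℕ} (h : NestedIndex a c n₀ n)
    (h0 : 1 ≤ n₀ (a + c)) {i : ℕ} (hi : a ≤ i) (hi' : i ≤ a + c) : 1 ≤ n i := by
  rcases hi'.lt_or_eq with hlt | rfl
  · exact (h.2 i hi hlt).1
  · rwa [h.1 _ le_rfl]

theorem NestedIndex.update {a c : ℕ} {n₀ n : ℕ → ℕ} {x : ℕ} (h : NestedIndex (a + 1) c n₀ n)
    (hx : 1 ≤ x) (hx' : x ≤ n (a + 1)) :
    NestedIndex a (c + 1) n₀ (Function.update n a x) := by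
  refine ⟨fun i hi => ?_, fun i hi hi' => ?_⟩
  · rw [Function.update_of_ne (by omega), h.1 i (by omega)]
  · rw [Function.update_of_ne (show i + 1 ≠ a by omega)]
    rcases (show i = a ∨ a + 1 ≤ i by omega) with rfl | hlt
    · simpa using ⟨hx, hx'⟩
    · rw [Function.update_of_ne (by omega)]
      exact h.2 i hlt (by omega)

/-- Since `n_i ≤ n_{i+1}`, each shifted argument is at least `k_i`. -/
theorem admissible_shiftedArg {m : ℕ} {k n : ℕ → ℕ} (hm : 2 ≤ m) (hk : MZVAdmissible m k)
    (h : NestedIndex 1 (m - 1) k n) : MZVAdmissible (m - 1) (shiftedArg k n) := by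
  have hle : ∀ i, 1 ≤ i → i ≤ m - 1 → k i ≤ shiftedArg k n i := fun i hi hi' => by
    have := (h.2 i hi (by omega)).2
    unfold shiftedArg
    omega
  refine ⟨hk.1.trans (hle 1 le_rfl (by omega)), fun i hi => ?_⟩
  have hi := Finset.mem_Icc.1 hi
  exact (hk.2 i (Finset.mem_Icc.2 ⟨hi.1, by omega⟩)).trans (hle i hi.1 hi.2)

/-- At position `j` the bound is `n_j ≤ k_j` instead of `n_j ≤ n_{j+1}`, so there the shifted
argument is at least `n_{j+1}`. Only `j = 1` puts `n_j` in the leading place, where it must be at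
least `2`. -/
theorem admissible_boundaryArgs {m j x : ℕ} {k n : ℕ → ℕ} (hj : 1 ≤ j) (hjm : j + 1 ≤ m)
    (hk : MZVAdmissible m k) (h : NestedIndex (j + 1) (m - 1 - j) k n) (hx : 1 ≤ x)
    (hxk : x ≤ k j) (hxj : j = 1 → 2 ≤ x) :
    MZVAdmissible m (boundaryArgs k (Function.update n j x) j) := by
  have hk2 := hk.1
  have hk1 : ∀ i, 1 ≤ i → i ≤ m → 1 ≤ k i := fun i hi hi' => hk.2 i (Finset.mem_Icc.2 ⟨hi, hi'⟩)
  have hsum : j + 1 + (m - 1 - j) = m := by omega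
  have hnj : 1 ≤ n (j + 1) :=
    h.one_le_apply (by rw [hsum]; exact hk1 m (by omega) le_rfl) le_rfl (by omega)
  constructor
  · rcases (show j = 1 ∨ 1 < j by omega) with rfl | hlt
    · simpa [boundaryArgs] using hxj rfl
    · simpa [boundaryArgs, hlt] using hk2
  · intro i hi
    have hi := Finset.mem_Icc.1 hi
    unfold boundaryArgs
    split_ifs with h1 h2
    · exact hk1 i hi.1 hi.2
    · simpa using hx
    · rcases (show i = j + 1 ∨ j < i - 1 by omega) with rfl | hlt
      · rw [Nat.add_sub_cancel, shiftedArg_update_self]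
        omega
      · rw [shiftedArg_update_of_lt k n x hlt]
        have h3 := (h.2 (i - 1) (by omega) (by omega)).2
        have h4 := hk1 (i - 1) (by omega) (by omega)
        unfold shiftedArg
        omega

theorem tendsto_boundarySum {m j l : ℕ} {k : ℕ → ℕ} (hj : 1 ≤ j) (hjm : j + 1 ≤ m)
    (hk : MZVAdmissible m k) (hl : 1 ≤ l) (hlj : j = 1 → 2 ≤ l) :
    Tendsto (fun N => boundarySum (mzvCut N) m k j l) atTop (𝓝 (boundarySum mzv m k j l)) := by
  simp only [boundarySum_eq]
  refine (tendsto_nestedSum fun n hn => tendsto_finsetSum _ fun x hx => ?_).const_mul _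
  have hx := Finset.mem_Icc.1 hx
  exact (tendsto_mzvCut (by omega) (admissible_boundaryArgs hj hjm hk hn (hl.trans hx.1) hx.2
    fun h => (hlj h).trans hx.1)).const_mul _

theorem tendsto_productSum {m : ℕ} {k : ℕ → ℕ} (hm : 2 ≤ m) (hk : MZVAdmissible m k) :
    Tendsto (fun N => productSum (mzvCut N) m k 2) atTop (𝓝 (productSum mzv m k 2)) := by
  simp only [productSum_eq]
  refine tendsto_nestedSum fun n hn => tendsto_finsetSum _ fun x hx => ?_
  have hx := Finset.mem_Icc.1 hx
  have hn' := hn.update (a := 1) (x := x) (by omega) hx.2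
  rw [show m - 2 + 1 = m - 1 by omega] at hn'
  refine Tendsto.const_mul _ (Tendsto.mul (tendsto_mzvCut le_rfl ⟨?_, fun i _ => ?_⟩)
    (tendsto_mzvCut (by omega) (admissible_shiftedArg hm hk hn')))
  · simpa using hx.1
  · simpa using (by omega : 1 ≤ x)

theorem tendsto_sum_boundarySum_add_productSum {m : ℕ} {k : ℕ → ℕ} (hm : 2 ≤ m)
    (hk : MZVAdmissible m k) :
    Tendsto (fun N : ℕ => ∑ j ∈ Finset.Icc 1 (m - 1), boundarySum (mzvCut N) m k j 1 +
      productSum (mzvCut N) m k 1) atTop (𝓝 (mzv m k)) := by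
  have hdiff : Tendsto (fun N => nestedSum
      (fun n => productTerm (mzvCut N) m k n - convTerm N m k n) 1 (m - 1) k) atTop
      (𝓝 (nestedSum (fun _ => 0) 1 (m - 1) k)) := by
    refine tendsto_nestedSum fun n hn => ?_
    have hs := admissible_shiftedArg hm hk hn
    have hn1 := (hn.2 1 le_rfl (by omega)).1
    obtain ⟨r, hr⟩ := Nat.exists_eq_add_of_le' (show 1 ≤ m - 1 by omega)
    simp only [productTerm, convTerm, ← mul_sub]
    rw [hr] at hs ⊢
    simpa using (tendsto_mul_sub_convSum hn1 hs).const_mul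
      ((-1) ^ (k m - n 1) * binomProd m k n 1)
  have h0 : nestedSum (fun _ => 0) 1 (m - 1) k = 0 := by
    simpa using nestedSum_const_mul 0 (fun _ => 0) 1 (m - 1) k
  rw [h0] at hdiff
  have := (tendsto_mzvCut (by omega) hk).add hdiff
  rw [add_zero] at this
  refine this.congr fun N => ?_
  rw [mzvCut_eq_sum_boundarySum (by omega) hk.2, productSum_one_eq _ hm, add_assoc,
    ← nestedSum_add]
  simp only [add_sub_cancel]

/-! ### Cancellation of the divergent terms -/

theorem sum_Icc_one_eq {b : ℕ} (hb : 1 ≤ b) (f : ℕ → ℝ) :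
    ∑ x ∈ Finset.Icc 1 b, f x = ∑ x ∈ Finset.Icc 2 b, f x + f 1 := by
  rw [← Finset.add_sum_Ioc_eq_sum_Icc hb, add_comm]
  rfl

theorem mzvCut_boundaryArgs_one {m : ℕ} (hm : 1 ≤ m) (N : ℕ) (k n : ℕ → ℕ) (hn : n 1 = 1) :
    mzvCut N m (boundaryArgs k n 1) = mzvCut N (m - 1 + 1) (consOne (shiftedArg k n)) := by
  rw [Nat.sub_add_cancel hm, mzvCut_eq_iterSum, mzvCut_eq_iterSum,
    iterSum_congr (t := consOne (shiftedArg k n)) (b := 1)]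
  intro i _
  simp only [boundaryArgs, consOne, if_neg (show ¬ 1 + i < 1 by omega), hn]

theorem boundarySum_add_productSum_one (N : ℕ) {m : ℕ} {k : ℕ → ℕ} (hm : 2 ≤ m)
    (hk : MZVAdmissible m k) :
    boundarySum (mzvCut N) m k 1 1 + productSum (mzvCut N) m k 1 =
      boundarySum (mzvCut N) m k 1 2 + productSum (mzvCut N) m k 2 +
        -(-1) ^ k m * nestedSum (fun n' =>
          let n := Function.update n' 1 1
          binomProd m k n 1 * (mzvCut N 1 (fun _ => 1) * mzvCut N (m - 1) (shiftedArg k n) -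
            mzvCut N (m - 1 + 1) (consOne (shiftedArg k n)))) 2 (m - 2) k := by
  have hkm : 1 ≤ k m := hk.2 m (Finset.mem_Icc.2 ⟨by omega, le_rfl⟩)
  have hk1 := hk.1
  simp only [boundarySum_eq, productSum_eq, show m - 1 - 1 = m - 2 by omega,
    ← nestedSum_const_mul, ← nestedSum_add, show 1 + 1 = 2 from rfl]
  refine nestedSum_congr fun n hn => ?_
  have hn2 : 1 ≤ n 2 := hn.one_le_apply
    (by rwa [show 2 + (m - 2) = m by omega]) le_rfl (by omega)
  rw [boundaryTerm, sum_Icc_one_eq (show 1 ≤ k 1 by omega), sum_Icc_one_eq hn2, ← boundaryTerm]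
  simp only [productTerm]
  rw [mzvCut_boundaryArgs_one (by omega) N k _ (by simp), binomProd_eq_mul k _ (a := 1) (show 1 < m by omega),
    shiftedArg_update_self, Function.update_self,
    Function.update_of_ne (show 1 + 1 ≠ 1 by norm_num)]
  -- For `n_1 = 1` the two lower indices `k_1 - 1` and `n_2 - 1` add up to the upper one, so
  -- symmetry makes the binomials agree.
  rw [show (k 1 + n (1 + 1) - 1 - 1).choose (k 1 - 1) =
      (k 1 + n (1 + 1) - 1 - 1).choose (n (1 + 1) - 1) from Nat.choose_symm_of_eq_add (by
        have : 1 ≤ n (1 + 1) := hn2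
        omega)]
  -- As `k_m ≥ 1`, the signs `(-1) ^ k m` and `(-1) ^ (k m - 1)` are opposite.
  obtain ⟨d, hd⟩ := Nat.exists_eq_add_of_le' hkm
  rw [hd, Nat.add_sub_cancel, pow_succ]
  ring

theorem tendsto_cancelledSum {m : ℕ} {k : ℕ → ℕ} (hm : 2 ≤ m) (hk : MZVAdmissible m k) :
    Tendsto (fun N => -(-1) ^ k m * nestedSum (fun n' =>
      let n := Function.update n' 1 1
      binomProd m k n 1 * (mzvCut N 1 (fun _ => 1) * mzvCut N (m - 1) (shiftedArg k n) -
        mzvCut N (m - 1 + 1) (consOne (shiftedArg k n)))) 2 (m - 2) k) atTop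
      (𝓝 (cancelledSum m k)) := by
  have hkm : 1 ≤ k m := hk.2 m (Finset.mem_Icc.2 ⟨by omega, le_rfl⟩)
  refine Tendsto.const_mul _ (tendsto_nestedSum fun n hn => Tendsto.const_mul _ ?_)
  have hn2 : 1 ≤ n 2 := hn.one_le_apply
    (by rwa [show 2 + (m - 2) = m by omega]) le_rfl (by omega)
  have hn' := hn.update (a := 1) le_rfl hn2
  rw [show m - 2 + 1 = m - 1 by omega] at hn'
  exact tendsto_mzvCut_one_mul_sub (by omega) (admissible_shiftedArg hm hk hn')

theorem mzv_eq_sum_boundarySum {m : ℕ} {k : ℕ → ℕ} (hm : 2 ≤ m) (hk : MZVAdmissible m k) :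
    mzv m k = ∑ j ∈ Finset.Icc 2 (m - 1), boundarySum mzv m k j 1 +
      boundarySum mzv m k 1 2 + productSum mzv m k 2 + cancelledSum m k := by
  refine tendsto_nhds_unique (tendsto_sum_boundarySum_add_productSum hm hk) ?_
  have h1 : Tendsto (fun N => ∑ j ∈ Finset.Icc 2 (m - 1), boundarySum (mzvCut N) m k j 1) atTop
      (𝓝 (∑ j ∈ Finset.Icc 2 (m - 1), boundarySum mzv m k j 1)) :=
    tendsto_finsetSum _ fun j hj => by
      have := Finset.mem_Icc.1 hj
      exact tendsto_boundarySum (by omega) (by omega) hk le_rfl (by omega)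
  refine (((h1.add (tendsto_boundarySum le_rfl (by omega) hk (l := 2) (by norm_num)
    fun _ => le_rfl)).add (tendsto_productSum hm hk)).add (tendsto_cancelledSum hm hk)).congr
    fun N => ?_
  rw [sum_Icc_one_eq (by omega), add_assoc _ (boundarySum (mzvCut N) m k 1 1),
    boundarySum_add_productSum_one N hm hk]
  ring

theorem mainTheorem4 :
    -- the series of every convergent argument tuple converges
    (∀ (r : ℕ) (s : ℕ → ℕ), 1 ≤ r → MZVAdmissible r s →
      Summable (fun n : MZVIndex r => mzvTerm r s n.val)) ∧
    -- the divergences of `ζ(1) ζ(s) - ζ(1, s)` cancel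
    (∀ (r : ℕ) (s : ℕ → ℕ), 1 ≤ r → MZVAdmissible r s →
      Tendsto
        (fun N : ℕ => mzvCut N 1 (fun _ => 1) * mzvCut N r s - mzvCut N (r + 1) (consOne s))
        atTop (𝓝 (reflSum r s))) ∧
    ∀ (m : ℕ) (k : ℕ → ℕ), 2 ≤ m → MZVAdmissible m k →
      -- the identity as it stands, all sums on its right hand side being cut off at `N → ∞`
      Tendsto
        (fun N : ℕ =>
          ∑ j ∈ Finset.Icc 1 (m - 1), boundarySum (mzvCut N) m k j 1
            + productSum (mzvCut N) m k 1)
        atTop (𝓝 (mzv m k)) ∧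
      -- the identity in terms of convergent sums only
      mzv m k =
        ∑ j ∈ Finset.Icc 2 (m - 1), boundarySum mzv m k j 1
          + boundarySum mzv m k 1 2 + productSum mzv m k 2 + cancelledSum m k := by
  exact ⟨fun _ _ hr hs => summable_mzvTerm hr hs,
    fun _ _ hr hs => tendsto_mzvCut_one_mul_sub hr hs,
    fun _ _ hm hk =>
      ⟨tendsto_sum_boundarySum_add_productSum hm hk, mzv_eq_sum_boundarySum hm hk⟩⟩
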